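/- There is an absolute constant $c>0$ such that the following holds. Let $0<\varepsilon\le 1/8$ and let $n,k$ be integers with $0<k\le n-1$. Call a probability distribution $p$ on $\{-1,1\}^n$ a junta distribution over $J\subseteq[n]$ if its probability mass function $p(x)$ depends only on the variables $x_i$, $i\in J$, and a $k$-junta distribution if it is a junta distribution over some $J$ with $|J|\le k$. Consider a randomized adaptive algorithm with general conditional query access to an unknown distribution $p$: each query is an arbitrary set $A\subseteq\{-1,1\}^n$, possibly depending on the previous answers and on internal randomness, and it is answered by a fresh sample $x\sim p$ conditioned on $x\in A$ (if $p(A)=0$, the answer is drawn from any fixed distribution on $\{-1,1\}^n$ that depends only on $A$, for instance the uniform distribution on $A$ when $A\neq\emptyset$). Suppose that, for every $k$-junta distribution $p$ on $\{-1,1\}^n$, with probability at least $4/5$ the algorithm outputs a set $J\subseteq[n]$ with $|J|\le k$ such that $p$ is $\varepsilon$-close to a junta distribution over $J$, that is, $d_{\mathrm{TV}}(p,g)=\frac12\sum_{x}|p(x)-g(x)|\le\varepsilon$ for some junta distribution $g$ over $J$. Suppose also that, for every $k$-junta distribution $p$, every execution of positive probability makes at most $q$ queries. Then $$q\;\ge\;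 c\cdot\frac{\log\binom nk}{\varepsilon^2}.$$ -/

import Mathlib

open scoped ENNReal

noncomputable section

namespace JuntaLearning

/-- The hypercube `{-1,1}^n`; the units of `ℤ` are exactly `1` and `-1`. -/
abbrev Cube (n : ℕ) : Type := Fin n → ℤˣ

/-- `p` is a junta distribution over `J`: its probability mass function depends only on the
variables in `J`. -/
def IsJuntaOver {n : ℕ} (J : Finset (Fin n)) (p : PMF (Cube n)) : Prop :=
  DependsOn (fun x => p x) (J : Set (Fin n))

/-- `p` is a `k`-junta distribution: its probability mass function depends on at most `k`
variables. -/
def IsKJunta {n : ℕ} (k : ℕ) (p : PMF (Cube n)) : Prop :=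
  ∃ J : Finset (Fin n), J.card ≤ k ∧ IsJuntaOver J p

/-- Total variation distance of two distributions on the hypercube. -/
def tvDist {n : ℕ} (p g : PMF (Cube n)) : ℝ :=
  (1 / 2) * ∑ x, |(p x).toReal - (g x).toReal|

/-- `p` is `ε`-close to some junta distribution over `J`. -/
def CloseToJuntaOver {n : ℕ} (ε : ℝ) (J : Finset (Fin n)) (p : PMF (Cube n)) : Prop :=
  ∃ g : PMF (Cube n), IsJuntaOver J g ∧ tvDist p g ≤ ε

/-- A convention for the oracle's answer to a query `A` that has probability zero under the
unknown distribution. The uniform distribution on `A` is one such convention. Pointing to an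
element outside `A` is another, which tells the algorithm that the query failed. -/
abbrev ZeroMassConvention (n : ℕ) : Type := Set (Cube n) → PMF (Cube n)

open scoped Classical in
/-- The general conditional sampling oracle for `p`: on a query `A ⊆ {-1,1}^n` with `p(A) > 0` it
returns a sample from `p` conditioned on `A`; if `p(A) = 0` it follows the convention `z`. -/
def condOracle {n : ℕ} (z : ZeroMassConvention n) (p : PMF (Cube n)) (A : Set (Cube n)) :
    PMF (Cube n) :=
  if h : ∃ x ∈ A, x ∈ p.support then p.filter A h else z A

/-- A deterministic adaptive algorithm with conditional query access: it stops with an output set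
of variables, or queries a set `A` and continues depending on the sample it receives. -/
inductive QueryTree (n : ℕ) : Type
  | output (J : Finset (Fin n)) : QueryTree n
  | query (A : Set (Cube n)) (next : Cube n → QueryTree n) : QueryTree n

/-- The joint law of the output and of the number of queries made, when the deterministic algorithm
is run with fresh independent answers drawn from the oracle `O`. -/
def QueryTree.run {n : ℕ} (O : Set (Cube n) → PMF (Cube n)) :
    QueryTree n → PMF (Finset (Fin n) × ℕ)
  | .output J => PMF.pure (J, 0)
  | .query A next => (O A).bind fun x => ((next x).run O).map fun r => (r.1, r.2 + 1)

/-- A randomized algorithm: a distribution over deterministic ones. -/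
abbrev Algorithm (n : ℕ) : Type := PMF (QueryTree n)

/-- The joint law of the output and of the number of queries made by a randomized algorithm. -/
def Algorithm.run {n : ℕ} (𝒜 : Algorithm n) (O : Set (Cube n) → PMF (Cube n)) :
    PMF (Finset (Fin n) × ℕ) :=
  PMF.bind 𝒜 fun T => T.run O

/-- On every `k`-junta distribution, with probability at least `4/5` the algorithm outputs a set
`J` of at most `k` variables such that the distribution is `ε`-close to a junta distribution
over `J`. -/
def Algorithm.FindsRelevantVariables {n : ℕ} (𝒜 : Algorithm n) (z : ZeroMassConvention n)
    (k : ℕ) (ε : ℝ) : Prop :=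
  ∀ p : PMF (Cube n), IsKJunta k p →
    (4 / 5 : ℝ≥0∞) ≤ (Algorithm.run 𝒜 (condOracle z p)).toOuterMeasure
      {r | r.1.card ≤ k ∧ CloseToJuntaOver ε r.1 p}

/-- On every `k`-junta distribution, every execution of positive probability makes at most `q`
queries. -/
def Algorithm.MakesAtMost {n : ℕ} (𝒜 : Algorithm n) (z : ZeroMassConvention n)
    (k q : ℕ) : Prop :=
  ∀ p : PMF (Cube n), IsKJunta k p →
    ∀ r ∈ (Algorithm.run 𝒜 (condOracle z p)).support, r.2 ≤ q

end JuntaLearning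

end

open scoped ENNReal

noncomputable section

namespace JuntaLearning

/-! Tilt the uniform distribution by the parity of a `k`-set `J`, with bias `δ = 3ε`. Any junta
distribution missing a variable of `J` is at distance at least `δ / 2 > ε`, so the algorithm must
answer exactly `J` (`Algorithm.le_outputLaw_biased`). Yet no conditional query separates this
distribution well from uniform: the likelihood ratio of an answer has second moment at most `B = 1 +
O(ε²)`, whatever the set `A` (`secondMomentBound_biased`). By Cauchy–Schwarz along the query tree,
`P_J(J)² ≤ B ^ q * P_unif(J)` for deterministic algorithms (`QueryTree.outputLaw_sq_le`); a
linearized form covers randomized ones. Under uniform, some `J` is output with probability at most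
`1 / n.choose k`, hence `B ^ q ≥ 16/25 * n.choose k`. -/

variable {n : ℕ}

/-! ### Flipping one coordinate and parities -/

/-- The cube with the `i`-th coordinate negated. -/
def flip (i : Fin n) (x : Cube n) : Cube n := Function.update x i (-x i)

lemma flip_involutive (i : Fin n) : Function.Involutive (flip i) := by
  intro x
  simp [flip]

/-- Summing over the cube is invariant under negating one coordinate. -/
lemma sum_flip (i : Fin n) (f : Cube n → ℝ) : ∑ x, f (flip i x) = ∑ x, f x :=
  Equiv.sum_comp (flip_involutive i).toPerm f

/-- The parity of the variables in `J`. -/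
def parity (J : Finset (Fin n)) (x : Cube n) : ℝ := ∏ i ∈ J, ((x i : ℤ) : ℝ)

lemma parity_eq_one_or (J : Finset (Fin n)) (x : Cube n) : parity J x = 1 ∨ parity J x = -1 := by
  unfold parity
  induction J using Finset.induction_on with
  | empty => simp
  | insert i s hi ih =>
    rw [Finset.prod_insert hi]
    rcases Int.units_eq_one_or (x i) with h | h <;> rcases ih with h' | h' <;> simp [h, h']

lemma parity_sq (J : Finset (Fin n)) (x : Cube n) : parity J x ^ 2 = 1 := by
  rcases parity_eq_one_or J x with h | h <;> simp [h]

lemma abs_parity (J : Finset (Fin n)) (x : Cube n) : |parity J x| = 1 := by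
  rcases parity_eq_one_or J x with h | h <;> simp [h]

lemma parity_flip {J : Finset (Fin n)} {i : Fin n} (hi : i ∈ J) (x : Cube n) :
    parity J (flip i x) = -parity J x := by
  unfold parity
  rw [← Finset.mul_prod_erase J _ hi, ← Finset.mul_prod_erase J _ hi, ← neg_mul]
  congr 1
  · simp [flip]
  · refine Finset.prod_congr rfl fun j hj => ?_
    rw [flip, Function.update_of_ne (Finset.ne_of_mem_erase hj)]

lemma sum_parity {J : Finset (Fin n)} (hJ : J.Nonempty) : ∑ x, parity J x = 0 := by
  obtain ⟨i, hi⟩ := hJ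
  have h := sum_flip i (parity J)
  simp only [parity_flip hi, Finset.sum_neg_distrib] at h
  linarith

lemma card_cube : (Fintype.card (Cube n) : ℝ) = 2 ^ n := by
  simp

lemma one_add_mul_parity_pos {δ : ℝ} (h0 : 0 ≤ δ) (h1 : δ < 1) (J : Finset (Fin n))
    (x : Cube n) : 0 < 1 + δ * parity J x := by
  rcases parity_eq_one_or J x with h | h <;> rw [h] <;> linarith

/-! ### The biased parity distributions -/

/-- The uniform distribution tilted by the parity of `J`. -/
def biased (δ : ℝ) (h0 : 0 ≤ δ) (h1 : δ < 1) (J : Finset (Fin n)) (hJ : J.Nonempty) :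
    PMF (Cube n) :=
  PMF.ofFintype (fun x => ENNReal.ofReal ((1 + δ * parity J x) / 2 ^ n)) <| by
    rw [← ENNReal.ofReal_sum_of_nonneg fun x _ =>
        div_nonneg (one_add_mul_parity_pos h0 h1 J x).le (by positivity),
      ← Finset.sum_div, Finset.sum_add_distrib, ← Finset.mul_sum, sum_parity hJ]
    simp

section Biased

variable {δ : ℝ} {h0 : 0 ≤ δ} {h1 : δ < 1} {J : Finset (Fin n)} {hJ : J.Nonempty}

lemma biased_toReal (x : Cube n) :
    (biased δ h0 h1 J hJ x).toReal = (1 + δ * parity J x) / 2 ^ n := by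
  rw [biased, PMF.ofFintype_apply, ENNReal.toReal_ofReal]
  exact div_nonneg (one_add_mul_parity_pos h0 h1 J x).le (by positivity)

lemma mem_support_biased (x : Cube n) : x ∈ (biased δ h0 h1 J hJ).support := by
  rw [PMF.mem_support_iff]
  intro h
  have h' := biased_toReal (h0 := h0) (h1 := h1) (hJ := hJ) x
  rw [h, ENNReal.toReal_zero] at h'
  have := div_pos (one_add_mul_parity_pos h0 h1 J x) (by positivity : (0 : ℝ) < 2 ^ n)
  linarith

lemma isJuntaOver_biased : IsJuntaOver J (biased δ h0 h1 J hJ) := by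
  intro x y hxy
  have : parity J x = parity J y := Finset.prod_congr rfl fun i hi => by rw [hxy i hi]
  simp [biased, this]

/-- A junta distribution over variables that miss some variable of `J` is far from the biased
parity distribution of `J`. -/
lemma half_le_tvDist_biased {J' : Finset (Fin n)} {i : Fin n} (hi : i ∈ J) (hi' : i ∉ J')
    {g : PMF (Cube n)} (hg : IsJuntaOver J' g) :
    δ / 2 ≤ tvDist (biased δ h0 h1 J hJ) g := by
  have hgf : ∀ x, g (flip i x) = g x := fun x => hg fun j hj => by
    rw [flip, Function.update_of_ne]
    rintro rfl
    exact hi' hj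
  set p := biased δ h0 h1 J hJ
  have h2 : ∑ x, |(p (flip i x)).toReal - (g x).toReal| = ∑ x, |(p x).toReal - (g x).toReal| := by
    rw [← sum_flip i fun x => |(p x).toReal - (g x).toReal|]
    simp only [hgf]
  -- `g` agrees at `x` and `flip i x`, where `p` differs by `2δ / 2 ^ n`; apply the triangle
  -- inequality on each pair.
  have h3 : ∑ _x : Cube n, 2 * δ / 2 ^ n ≤
      ∑ x, (|(p x).toReal - (g x).toReal| + |(p (flip i x)).toReal - (g x).toReal|) := by
    refine Finset.sum_le_sum fun x _ => ?_
    have h4 : |(p x).toReal - (p (flip i x)).toReal| = 2 * δ / 2 ^ n := by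
      rw [biased_toReal, biased_toReal, parity_flip hi, ← sub_div, abs_div,
        abs_of_pos (by positivity : (0 : ℝ) < 2 ^ n)]
      congr 1
      rw [show 1 + δ * parity J x - (1 + δ * -parity J x) = 2 * δ * parity J x by ring, abs_mul,
        abs_parity, abs_of_nonneg (by linarith), mul_one]
    rw [← h4]
    have := abs_sub_le (p x).toReal (g x).toReal (p (flip i x)).toReal
    rwa [abs_sub_comm (g x).toReal] at this
  rw [Finset.sum_add_distrib, h2, Finset.sum_const, Finset.card_univ, nsmul_eq_mul, card_cube,
    mul_div_cancel₀ _ (by positivity)] at h3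
  unfold tvDist
  linarith

lemma eq_of_closeToJuntaOver_biased {ε : ℝ} (hε : ε < δ / 2) {J' : Finset (Fin n)}
    (hcard : J'.card ≤ J.card) (h : CloseToJuntaOver ε J' (biased δ h0 h1 J hJ)) : J' = J := by
  obtain ⟨g, hg, hd⟩ := h
  refine (Finset.eq_of_subset_of_card_le (fun i hi => ?_) hcard).symm
  by_contra hi'
  have := half_le_tvDist_biased (h0 := h0) (h1 := h1) (hJ := hJ) hi hi' hg
  linarith

end Biased

/-! ### Conditional samples -/

open scoped Classical in
lemma condOracle_toReal (z : ZeroMassConvention n) (p : PMF (Cube n)) (A : Set (Cube n))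
    (h : ∃ x ∈ A, x ∈ p.support) (x : Cube n) :
    (condOracle z p A x).toReal =
      if x ∈ A then (p x).toReal / ∑ y with y ∈ A, (p y).toReal else 0 := by
  rw [condOracle, dif_pos h, PMF.filter_apply, tsum_fintype, ENNReal.toReal_mul,
    ENNReal.toReal_inv, ENNReal.toReal_sum fun y _ =>
      ne_top_of_le_ne_top (p.apply_ne_top y) (Set.indicator_le_self A p y)]
  by_cases hx : x ∈ A
  · rw [if_pos hx, Set.indicator_of_mem hx, Finset.sum_filter, div_eq_mul_inv]
    congr 2
    refine Finset.sum_congr rfl fun y _ => ?_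
    by_cases hy : y ∈ A <;> simp [hy]
  · simp [hx]

/-- `O` is absolutely continuous with respect to `O'` on every query, and the second moment of the
likelihood ratio is at most `B`. -/
def SecondMomentBound (B : ℝ) (O O' : Set (Cube n) → PMF (Cube n)) : Prop :=
  ∀ A, (∀ x, O' A x = 0 → O A x = 0) ∧
    ∑ x, (O A x).toReal ^ 2 / (O' A x).toReal ≤ B

lemma sum_toReal (p : PMF (Cube n)) : ∑ x, (p x).toReal = 1 := by
  have h := p.tsum_coe
  rw [tsum_fintype] at h
  rw [← ENNReal.toReal_sum fun x _ => p.apply_ne_top x, h, ENNReal.toReal_one]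

/-- The left side exceeds `(a + δt)²` by `δ²(a² - t²) ≤ δ²a²`, and `a + δt ≥ 5/8 * a` gives `a² ≤
64/25 * (a + δt)²`. -/
lemma sq_ratio_le {δ a t : ℝ} (h0 : 0 ≤ δ) (h1 : δ ≤ 3 / 8) (ha : 0 < a) (ht : |t| ≤ a) :
    a * (a + 2 * δ * t + δ ^ 2 * a) ≤ (1 + 64 / 25 * δ ^ 2) * (a + δ * t) ^ 2 := by
  have hl : 5 / 8 * a ≤ a + δ * t := by
    have := mul_le_mul_of_nonneg_left (abs_le.mp ht).1 h0
    nlinarith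
  have hsq : (5 / 8 * a) ^ 2 ≤ (a + δ * t) ^ 2 := by gcongr
  nlinarith [mul_le_mul_of_nonneg_left hsq (sq_nonneg δ), sq_nonneg (δ * t)]

/-- Both distributions have full support, so the convention `z` matters only for `A = ∅`, where the
two oracles coincide. Otherwise, with `a = |A|` and `t` the sum of the parity over `A`, the moment
is the ratio in `sq_ratio_le`. -/
lemma secondMomentBound_biased {δ : ℝ} (h0 : 0 ≤ δ) (h1 : δ < 1) (hδ : δ ≤ 3 / 8)
    {J : Finset (Fin n)} (hJ : J.Nonempty) (z : ZeroMassConvention n) :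
    SecondMomentBound (1 + 64 / 25 * δ ^ 2) (condOracle z (biased δ h0 h1 J hJ))
      (condOracle z (PMF.uniformOfFintype (Cube n))) := by
  classical
  intro A
  rcases A.eq_empty_or_nonempty with rfl | ⟨x₀, hx₀⟩
  · simp only [condOracle, Set.mem_empty_iff_false, false_and, exists_false, dite_false]
    refine ⟨fun _ h => h, ?_⟩
    have : ∀ x, (z ∅ x).toReal ^ 2 / (z ∅ x).toReal = (z ∅ x).toReal := fun x => by
      rw [sq, mul_self_div_self]
    simp only [this, sum_toReal]
    nlinarith [sq_nonneg δ]
  · set p := biased δ h0 h1 J hJ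
    set u := PMF.uniformOfFintype (Cube n)
    have hp : ∃ x ∈ A, x ∈ p.support := ⟨x₀, hx₀, mem_support_biased x₀⟩
    have hu : ∃ x ∈ A, x ∈ u.support := ⟨x₀, hx₀, PMF.mem_support_uniformOfFintype x₀⟩
    have hureal : ∀ x, (u x).toReal = 1 / 2 ^ n := fun x => by
      rw [PMF.uniformOfFintype_apply, ENNReal.toReal_inv, ENNReal.toReal_natCast, card_cube,
        one_div]
    refine ⟨fun x hx => ?_, ?_⟩
    · have hxA : x ∉ A := fun hxA => by
        rw [condOracle, dif_pos hu, PMF.filter_apply_eq_zero_iff] at hx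
        exact hx.elim (· hxA) (· (PMF.mem_support_uniformOfFintype x))
      rw [condOracle, dif_pos hp]
      exact PMF.filter_apply_eq_zero_of_notMem hp hxA
    · set a : ℝ := ((Finset.univ.filter (· ∈ A)).card : ℝ) with ha
      set t : ℝ := ∑ y with y ∈ A, parity J y with htdef
      have hapos : 0 < a := by
        rw [ha, Nat.cast_pos, Finset.card_pos]
        exact ⟨x₀, by simpa using hx₀⟩
      have ht : |t| ≤ a := by
        refine (Finset.abs_sum_le_sum_abs _ _).trans ?_
        simp [abs_parity, ha]
      have hS : ∑ y with y ∈ A, (p y).toReal = (a + δ * t) / 2 ^ n := by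
        simp only [p, biased_toReal]
        rw [← Finset.sum_div, Finset.sum_add_distrib, ← Finset.mul_sum]
        simp [ha, htdef]
      have hU : ∑ y with y ∈ A, (u y).toReal = a / 2 ^ n := by
        simp only [hureal]
        rw [Finset.sum_const, nsmul_eq_mul, mul_one_div]
      have hSpos : 0 < a + δ * t := by
        have := mul_le_mul_of_nonneg_left (abs_le.mp ht).1 h0
        nlinarith
      have hterm : ∀ x, (condOracle z p A x).toReal ^ 2 / (condOracle z u A x).toReal =
          if x ∈ A then a / (a + δ * t) ^ 2 * (1 + 2 * δ * parity J x + δ ^ 2) else 0 := by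
        intro x
        rw [condOracle_toReal z p A hp, condOracle_toReal z u A hu, hS, hU, hureal, biased_toReal]
        by_cases hx : x ∈ A
        · simp only [if_pos hx]
          have : 1 + 2 * δ * parity J x + δ ^ 2 = (1 + δ * parity J x) ^ 2 := by
            linear_combination -δ ^ 2 * parity_sq J x
          rw [this]
          field_simp
        · simp [hx]
      simp only [hterm]
      rw [← Finset.sum_filter, ← Finset.mul_sum, Finset.sum_add_distrib, Finset.sum_add_distrib,
        ← Finset.mul_sum, Finset.sum_const, Finset.sum_const, nsmul_eq_mul, nsmul_eq_mul,
        div_mul_eq_mul_div, div_le_iff₀ (by positivity)]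
      have := sq_ratio_le h0 hδ hapos ht
      linarith

/-! ### Change of oracle -/

/-- The law of the output of a deterministic algorithm. -/
def QueryTree.outputLaw (O : Set (Cube n) → PMF (Cube n)) (T : QueryTree n) :
    PMF (Finset (Fin n)) :=
  (T.run O).map Prod.fst

lemma QueryTree.outputLaw_output (O : Set (Cube n) → PMF (Cube n)) (J : Finset (Fin n)) :
    (QueryTree.output J).outputLaw O = PMF.pure J := by
  simp [QueryTree.outputLaw, QueryTree.run, PMF.pure_map]

lemma QueryTree.outputLaw_query (O : Set (Cube n) → PMF (Cube n)) (A : Set (Cube n))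
    (next : Cube n → QueryTree n) :
    (QueryTree.query A next).outputLaw O = (O A).bind fun x => (next x).outputLaw O := by
  simp only [QueryTree.outputLaw, QueryTree.run, PMF.map_bind, PMF.map_comp]
  rfl

lemma QueryTree.outputLaw_query_toReal (O : Set (Cube n) → PMF (Cube n)) (A : Set (Cube n))
    (next : Cube n → QueryTree n) (J : Finset (Fin n)) :
    ((QueryTree.query A next).outputLaw O J).toReal =
      ∑ x, (O A x).toReal * ((next x).outputLaw O J).toReal := by
  rw [QueryTree.outputLaw_query, PMF.bind_apply, tsum_fintype, ENNReal.toReal_sum fun x _ =>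
    ENNReal.mul_ne_top (PMF.apply_ne_top _ _) (PMF.apply_ne_top _ _)]
  simp only [ENNReal.toReal_mul]

/-- Changing the oracle of an algorithm that makes at most `q` queries costs a factor `B ^ q` in
the squared probability of an output. -/
lemma QueryTree.outputLaw_sq_le {B : ℝ} (hB : 1 ≤ B) {O O' : Set (Cube n) → PMF (Cube n)}
    (hO : SecondMomentBound B O O') (J : Finset (Fin n)) (T : QueryTree n) :
    ∀ q : ℕ, (∀ r ∈ (T.run O).support, r.2 ≤ q) →
      (T.outputLaw O J).toReal ^ 2 ≤ B ^ q * (T.outputLaw O' J).toReal := by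
  induction T with
  | output J' =>
    intro q _
    rw [QueryTree.outputLaw_output, QueryTree.outputLaw_output, PMF.pure_apply]
    split_ifs
    · simpa using one_le_pow₀ hB
    · simp
  | query A next ih =>
    intro q hq
    have hstep : ∀ x ∈ (O A).support, ∀ r ∈ ((next x).run O).support, r.2 + 1 ≤ q := by
      intro x hx r hr
      refine hq (r.1, r.2 + 1) ?_
      rw [QueryTree.run, PMF.mem_support_bind_iff]
      exact ⟨x, hx, (PMF.mem_support_map_iff _ _ _).mpr ⟨r, hr, rfl⟩⟩
    obtain ⟨m, rfl⟩ : ∃ m, q = m + 1 := by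
      obtain ⟨x, hx⟩ := (O A).support_nonempty
      obtain ⟨r, hr⟩ := ((next x).run O).support_nonempty
      exact Nat.exists_eq_add_of_le' (Nat.le_trans (Nat.le_add_left 1 r.2) (hstep x hx r hr))
    obtain ⟨hac, hmom⟩ := hO A
    have hB0 : 0 ≤ B := zero_le_one.trans hB
    have hO0 : ∀ x, (O' A x).toReal = 0 → (O A x).toReal = 0 := fun x hx => by
      rw [hac x ((ENNReal.toReal_eq_zero_iff _).mp hx |>.resolve_right (PMF.apply_ne_top _ _)),
        ENNReal.toReal_zero]
    rw [QueryTree.outputLaw_query_toReal, QueryTree.outputLaw_query_toReal]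
    set w : Cube n → ℝ := fun x => ((next x).outputLaw O J).toReal
    -- The query budget, and so the induction hypothesis, is only available for answers possible
    -- under `O`; the others are cut off.
    set g : Cube n → ℝ := fun x => if O A x = 0 then 0 else (O' A x).toReal * w x ^ 2 with hg
    have hg0 : ∀ x, 0 ≤ g x := fun x => by
      simp only [hg]
      split_ifs <;> positivity
    calc (∑ x, (O A x).toReal * w x) ^ 2
        ≤ (∑ x, (O A x).toReal ^ 2 / (O' A x).toReal) * ∑ x, g x := by
          refine Finset.sum_sq_le_sum_mul_sum_of_sq_le_mul _ (fun x _ => by positivity)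
            (fun x _ => hg0 x) fun x _ => ?_
          simp only [hg]
          split_ifs with h
          · simp [h]
          · have : (O' A x).toReal ≠ 0 := fun h' =>
              ENNReal.toReal_ne_zero.mpr ⟨h, PMF.apply_ne_top _ _⟩ (hO0 x h')
            exact le_of_eq (by field_simp)
      _ ≤ B * ∑ x, g x := by
          gcongr
      _ ≤ B * ∑ x, (O' A x).toReal * (B ^ m * ((next x).outputLaw O' J).toReal) := by
          refine mul_le_mul_of_nonneg_left (Finset.sum_le_sum fun x _ => ?_) hB0
          simp only [hg]
          split_ifs with h
          · positivity
          · gcongr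
            exact ih x m fun r hr => Nat.le_of_succ_le_succ (hstep x h r hr)
      _ = B ^ (m + 1) * ∑ x, (O' A x).toReal * ((next x).outputLaw O' J).toReal := by
          rw [Finset.mul_sum, Finset.mul_sum]
          exact Finset.sum_congr rfl fun x _ => by ring

/-- The law of the output of a randomized algorithm. -/
def Algorithm.outputLaw (𝒜 : Algorithm n) (O : Set (Cube n) → PMF (Cube n)) :
    PMF (Finset (Fin n)) :=
  (Algorithm.run 𝒜 O).map Prod.fst

lemma Algorithm.outputLaw_eq_bind (𝒜 : Algorithm n) (O : Set (Cube n) → PMF (Cube n)) :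
    Algorithm.outputLaw 𝒜 O = PMF.bind 𝒜 fun T => T.outputLaw O := by
  simp only [Algorithm.outputLaw, Algorithm.run, PMF.map_bind]
  rfl

/-- The linearized form of `QueryTree.outputLaw_sq_le`, averaged over the randomness of the
algorithm. -/
lemma Algorithm.two_mul_outputLaw_le {B : ℝ} (hB : 1 ≤ B) {O O' : Set (Cube n) → PMF (Cube n)}
    (hO : SecondMomentBound B O O') (J : Finset (Fin n)) (𝒜 : Algorithm n) (q : ℕ)
    (hq : ∀ r ∈ (Algorithm.run 𝒜 O).support, r.2 ≤ q) {s : ℝ} (hs : 0 ≤ s) :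
    2 * s * (Algorithm.outputLaw 𝒜 O J).toReal ≤
      s ^ 2 + B ^ q * (Algorithm.outputLaw 𝒜 O' J).toReal := by
  have hB0 : 0 ≤ B := zero_le_one.trans hB
  have hT : ∀ T : QueryTree n, 𝒜 T * (ENNReal.ofReal (2 * s) * T.outputLaw O J) ≤
      𝒜 T * (ENNReal.ofReal (s ^ 2) + ENNReal.ofReal (B ^ q) * T.outputLaw O' J) := by
    intro T
    by_cases h : 𝒜 T = 0
    · simp [h]
    gcongr
    have h1 := T.outputLaw_sq_le hB hO J q fun r hr =>
      hq r ((PMF.mem_support_bind_iff _ _ _).mpr ⟨T, h, hr⟩)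
    rw [← ENNReal.ofReal_toReal (PMF.apply_ne_top (T.outputLaw O) J),
      ← ENNReal.ofReal_toReal (PMF.apply_ne_top (T.outputLaw O') J),
      ← ENNReal.ofReal_mul (by positivity), ← ENNReal.ofReal_mul (by positivity),
      ← ENNReal.ofReal_add (by positivity) (by positivity)]
    refine ENNReal.ofReal_le_ofReal ?_
    -- `2sa ≤ s² + a²` makes the bound linear in the output probabilities, so it can be averaged
    -- over `T`.
    nlinarith [sq_nonneg (s - (T.outputLaw O J).toReal)]
  have hsum := ENNReal.tsum_le_tsum hT
  simp only [mul_add, mul_left_comm (𝒜 _)] at hsum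
  rw [ENNReal.tsum_add, ENNReal.tsum_mul_left, ENNReal.tsum_mul_left, ENNReal.tsum_mul_right,
    PMF.tsum_coe, one_mul, ← PMF.bind_apply, ← PMF.bind_apply,
    ← Algorithm.outputLaw_eq_bind, ← Algorithm.outputLaw_eq_bind] at hsum
  have hne : ENNReal.ofReal (B ^ q) * Algorithm.outputLaw 𝒜 O' J ≠ ∞ :=
    ENNReal.mul_ne_top ENNReal.ofReal_ne_top (PMF.apply_ne_top _ _)
  have := ENNReal.toReal_mono (ENNReal.add_ne_top.mpr ⟨ENNReal.ofReal_ne_top, hne⟩) hsum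
  rwa [ENNReal.toReal_add ENNReal.ofReal_ne_top hne, ENNReal.toReal_mul, ENNReal.toReal_mul,
    ENNReal.toReal_ofReal (by positivity), ENNReal.toReal_ofReal (by positivity),
    ENNReal.toReal_ofReal (by positivity)] at this

/-! ### Pigeonhole over the candidate sets and numerical estimates -/

/-- Some member of a nonempty finite set has at most the average mass. -/
lemma exists_card_mul_toReal_le_one {α : Type*} (p : PMF α) {S : Finset α} (hS : S.Nonempty) :
    ∃ a ∈ S, (S.card : ℝ) * (p a).toReal ≤ 1 := by
  by_contra! h
  have h1 : ∑ a ∈ S, (p a).toReal ≤ 1 := by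
    rw [← ENNReal.toReal_sum fun a _ => p.apply_ne_top a, ← ENNReal.toReal_one, ← p.tsum_coe]
    exact ENNReal.toReal_mono p.tsum_coe_ne_top (ENNReal.sum_le_tsum S)
  have h2 : ∑ a ∈ S, (1 : ℝ) < ∑ a ∈ S, (S.card : ℝ) * (p a).toReal :=
    Finset.sum_lt_sum_of_nonempty hS h
  rw [← Finset.mul_sum, Finset.sum_const, nsmul_eq_mul, mul_one] at h2
  nlinarith [(Nat.cast_nonneg S.card : (0 : ℝ) ≤ S.card)]

/-- An algorithm that finds the relevant variables outputs `J` with probability at least `4/5` on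
the biased parity distribution of `J`. -/
lemma Algorithm.le_outputLaw_biased {k : ℕ} {ε δ : ℝ} {z : ZeroMassConvention n} {𝒜 : Algorithm n}
    (hF : Algorithm.FindsRelevantVariables 𝒜 z k ε) (h0 : 0 ≤ δ) (h1 : δ < 1) (hε : ε < δ / 2)
    {J : Finset (Fin n)} (hJ : J.Nonempty) (hcard : J.card = k) :
    4 / 5 ≤ (Algorithm.outputLaw 𝒜 (condOracle z (biased δ h0 h1 J hJ)) J).toReal := by
  have h := hF _ ⟨J, hcard.le, isJuntaOver_biased (h0 := h0) (h1 := h1) (hJ := hJ)⟩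
  have hle : (4 / 5 : ℝ≥0∞) ≤
      Algorithm.outputLaw 𝒜 (condOracle z (biased δ h0 h1 J hJ)) J := by
    refine h.trans ?_
    rw [← PMF.toOuterMeasure_apply_singleton, Algorithm.outputLaw,
      PMF.toOuterMeasure_map_apply]
    refine MeasureTheory.OuterMeasure.mono _ ?_
    rintro r ⟨hr1, hr2⟩
    exact eq_of_closeToJuntaOver_biased hε (hr1.trans hcard.ge) hr2
  have := ENNReal.toReal_mono (PMF.apply_ne_top _ _) hle
  simpa [ENNReal.toReal_div] using this

lemma quarter_log_le_log {N : ℝ} (hN : 2 ≤ N) : 1 / 4 * Real.log N ≤ Real.log (16 / 25 * N) := by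
  rw [Real.log_mul (by norm_num) (by positivity)]
  -- The claim is `N ≤ (16/25 * N)⁴`, whose worst case is `N = 2`.
  have h1 : (0 : ℝ) ≤ Real.log ((16 / 25) ^ 4 * 2 ^ 3) := Real.log_nonneg (by norm_num)
  rw [Real.log_mul (by norm_num) (by norm_num), Real.log_pow, Real.log_pow] at h1
  have h2 := Real.log_le_log (by norm_num) hN
  push_cast at h1
  linarith

lemma two_le_choose {k : ℕ} (hk : 0 < k) (hkn : k < n) : 2 ≤ n.choose k := by
  obtain ⟨m, rfl⟩ := Nat.exists_eq_succ_of_ne_zero (Nat.ne_of_gt (hk.trans hkn))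
  obtain ⟨j, rfl⟩ := Nat.exists_eq_succ_of_ne_zero hk.ne'
  simp only [Nat.succ_eq_add_one] at hkn ⊢
  rw [Nat.choose_succ_succ']
  have h1 : 0 < m.choose j := Nat.choose_pos (by omega)
  have h2 : 0 < m.choose (j + 1) := Nat.choose_pos (by omega)
  omega

end JuntaLearning

end

open JuntaLearning in
theorem theorem3 :
    ∃ c : ℝ, 0 < c ∧
      ∀ (n k : ℕ) (ε : ℝ), 0 < ε → ε ≤ 1 / 8 → 0 < k → k < n →
      ∀ (z : JuntaLearning.ZeroMassConvention n) (𝒜 : JuntaLearning.Algorithm n) (q : ℕ),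
        JuntaLearning.Algorithm.FindsRelevantVariables 𝒜 z k ε →
        JuntaLearning.Algorithm.MakesAtMost 𝒜 z k q →
        c * (Real.log (n.choose k : ℝ) / ε ^ 2) ≤ (q : ℝ) := by
  -- `96 = 4 * 24`: the `1/4` from `quarter_log_le_log`, the `24` from the exponent in `hpow`.
  refine ⟨1 / 96, by norm_num, fun n k ε hε hε8 hk hkn z 𝒜 q hF hM => ?_⟩
  have hN : (2 : ℝ) ≤ n.choose k := by exact_mod_cast two_le_choose hk hkn
  have hScard : (Finset.powersetCard k (Finset.univ : Finset (Fin n))).card = n.choose k := by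
    simp
  obtain ⟨J, hJS, hJQ⟩ := exists_card_mul_toReal_le_one
    (Algorithm.outputLaw 𝒜 (condOracle z (PMF.uniformOfFintype (Cube n))))
    (Finset.card_pos.mp (hScard ▸ Nat.choose_pos hkn.le))
  rw [hScard] at hJQ
  have hJk : J.card = k := (Finset.mem_powersetCard.mp hJS).2
  have hJ : J.Nonempty := Finset.card_pos.mp (hJk ▸ hk)
  -- `δ = 3ε` satisfies both `ε < δ / 2` and, as `ε ≤ 1/8`, `δ ≤ 3/8`.
  have h0 : (0 : ℝ) ≤ 3 * ε := by positivity
  have h1 : 3 * ε < 1 := by linarith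
  have hP := Algorithm.le_outputLaw_biased hF h0 h1 (by linarith) hJ hJk
  have hB : 1 ≤ 1 + 64 / 25 * (3 * ε) ^ 2 := by
    have := sq_nonneg (3 * ε)
    linarith
  have hmain := Algorithm.two_mul_outputLaw_le hB
    (secondMomentBound_biased h0 h1 (by linarith) hJ z) J 𝒜 q
    (hM _ ⟨J, hJk.le, isJuntaOver_biased⟩) (s := 4 / 5) (by norm_num)
  -- `64/25 * 9 = 23.04 ≤ 24`.
  have hpow : (1 + 64 / 25 * (3 * ε) ^ 2) ^ q ≤ Real.exp (q * (24 * ε ^ 2)) := by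
    rw [Real.exp_nat_mul]
    refine pow_le_pow_left₀ (by positivity) ?_ q
    have := Real.add_one_le_exp (24 * ε ^ 2)
    nlinarith [sq_nonneg ε]
  set Q := (Algorithm.outputLaw 𝒜 (condOracle z (PMF.uniformOfFintype (Cube n))) J).toReal
  have hkey : 16 / 25 * (n.choose k : ℝ) ≤ Real.exp (q * (24 * ε ^ 2)) := by
    -- `2 * (4/5) * (4/5) - (4/5)² = 16/25`, from `hmain` and `hP`.
    have h2 : 16 / 25 ≤ (1 + 64 / 25 * (3 * ε) ^ 2) ^ q * Q := by linarith
    calc 16 / 25 * (n.choose k : ℝ)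
        ≤ ((1 + 64 / 25 * (3 * ε) ^ 2) ^ q * Q) * n.choose k := by gcongr
      _ = (1 + 64 / 25 * (3 * ε) ^ 2) ^ q * (n.choose k * Q) := by ring
      _ ≤ (1 + 64 / 25 * (3 * ε) ^ 2) ^ q * 1 := by gcongr
      _ ≤ Real.exp (q * (24 * ε ^ 2)) := by rwa [mul_one]
  have hlog := Real.log_le_log (by positivity) hkey
  rw [Real.log_exp] at hlog
  have := quarter_log_le_log hN
  rw [← mul_div_assoc, div_le_iff₀ (by positivity)]
  linarith
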